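/- Let $\mathbb N=\{1,2,3,\dots\}$, $\mathbb K\in\{\mathbb R,\mathbb C\}$, $\omega=\mathbb K^{\mathbb N}$, and let $V=(v^{(m)})_{m\in\mathbb N}$ be a decreasing sequence of strictly positive weights, i.e. $v^{(m)}\in(0,\infty)^{\mathbb N}$ and $v^{(m)}_j\ge v^{(m+1)}_j$ for all $m,j$. For $1\le p<\infty$ let $\ell_p(v^{(m)})=\{x\in\omega:\ (x_jv^{(m)}_j)_j\in\ell_p\}$ with the norm $\|(x_jv^{(m)}_j)_j\|_{\ell_p}$, for $p=0$ let $c_0(v^{(m)})=\{x\in\omega:\ (x_jv^{(m)}_j)_j\in c_0\}$ with the norm $\sup_j|x_j|v^{(m)}_j$, and let $k_p(V)$ be the inductive limit of these spaces, that is, their union over $m$ with the finest locally convex topology for which all inclusions of the step spaces are continuous. A symbol is a bijection $\psi:\mathbb N\to\mathbb N\setminus\{1\}$ with $\mathbb N=\{1\}\cup\{\psi^n(1):n\in\mathbb N\}$; a weight sequence is $w=(w_j)_j\in\omega$ with $w_j\ne0$ for all $j$; and $B_{w,\psi}:\omega\to\omega$, $B_{w,\psi}x=(w_{\psi(j)}x_{\psi(j)})_{j\in\mathbb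 N}$, is the weighted generalized backward shift. For a continuous self-map $T$ of a topological space $E$ and non-empty open sets $U,W\subseteq E$ put $N_T(U,W)=\{n\in\mathbb N:\ T^n(U)\cap W\ne\emptyset\}$. A set $I\subseteq\mathbb N$ is thick if for every $q\in\mathbb N$ there is $j\in\mathbb N$ with $\{j,j+1,\dots,j+q\}\subseteq I$, and syndetic if there is $q\in\mathbb N$ such that $\{n,\dots,n+q\}\cap I\ne\emptyset$ for all $n\in\mathbb N$. $T$ is transitive (mixing, topologically ergodic) if all the sets $N_T(U,W)$ are non-empty (cofinite, syndetic); hypercyclic if some orbit $\{x,Tx,T^2x,\dots\}$ is dense in $E$; sequentially hypercyclic if there is an orbit such that every point of $E$ is the limit of a sequence in that orbit; chaotic if it is transitive and its periodic points are dense in $E$. **Theorem.** Let $p\in\{0\}\cup[1,\infty)$, let $\psi$ be a symbol, $w$ a weight sequence and $V=(v^{(m)})_{m}$ a decreasing sequence of strictly positive weights such that $B_{w,\psi}$ is a well-defined, continuous linear operator on $k_p(V)$. Put $$c^{(m)}_j=\frac{v^{(m)}_{\psi^j(1)}}{\prod_{l=0}^{j}|w_{\psi^l(1)}|}\qquad(m,j\in\mathbb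 N,\ \psi^0(1)=1).$$ Then the following hold for $B_{w,\psi}$ on $k_p(V)$. (a) $B_{w,\psi}$ is transitive if and only if there is $m\in\mathbb N$ with $\liminf_{j\to\infty}c^{(m)}_j=0$. (b) The following are equivalent: (i) $B_{w,\psi}$ is sequentially hypercyclic; (ii) $B_{w,\psi}$ is hypercyclic; (iii) there are $m\in\mathbb N$ and a thick set $I\subseteq\mathbb N$ with $\lim_{I\ni j\to\infty}c^{(m)}_j=0$. (c) $B_{w,\psi}$ is mixing if and only if for every infinite set $I\subseteq\mathbb N$ there is $m\in\mathbb N$ with $\liminf_{I\ni j\to\infty}c^{(m)}_j=0$. (d) If there is $m\in\mathbb N$ such that for every $\varepsilon>0$ the set $\{j\in\mathbb N:\ c^{(m)}_j<\varepsilon\}$ is syndetic, then $B_{w,\psi}$ is topologically ergodic. (e) The following are equivalent: (i) $B_{w,\psi}$ has a periodic point $x\in k_p(V)$, $x\ne0$; (ii) there is $m\in\mathbb N$ with $(c^{(m)}_j)_{j\in\mathbb N}\in\ell_p$ (respectively $\in c_0$ if $p=0$); (iii) $B_{w,\psi}$ is chaotic. -/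

import Mathlib

open Filter Topology Set
open scoped ENNReal

/-! ### Topological dynamics -/

namespace LinDyn

variable {X : Type*} [TopologicalSpace X]

/-- The return set `N_T(U, W) = {n ≥ 1 : T^n(U) ∩ W ≠ ∅}`. -/
def returnSet (T : X → X) (U W : Set X) : Set ℕ :=
  {n | 1 ≤ n ∧ ((T^[n] '' U) ∩ W).Nonempty}

/-- Thick sets of positive integers: they contain `{j, …, j + p}` for every `p` and some `j ≥ 1`. -/
def IsThick (I : Set ℕ) : Prop :=
  ∀ p : ℕ, ∃ j : ℕ, 1 ≤ j ∧ ∀ i ≤ p, j + i ∈ I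

/-- Syndetic sets of positive integers: for some `p`, they meet `{n, …, n + p}` for every
`n ≥ 1`. -/
def IsSyndetic (A : Set ℕ) : Prop :=
  ∃ p : ℕ, ∀ n : ℕ, 1 ≤ n → ∃ i ≤ p, n + i ∈ A

/-- Topological transitivity. -/
def IsTransitive (T : X → X) : Prop :=
  ∀ U W : Set X, IsOpen U → U.Nonempty → IsOpen W → W.Nonempty → (returnSet T U W).Nonempty

/-- Topological mixing: all return sets are cofinite. -/
def IsMixing (T : X → X) : Prop :=
  ∀ U W : Set X, IsOpen U → U.Nonempty → IsOpen W → W.Nonempty → ((returnSet T U W)ᶜ).Finite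

/-- Topological ergodicity: all return sets are syndetic. -/
def IsTopErgodic (T : X → X) : Prop :=
  ∀ U W : Set X, IsOpen U → U.Nonempty → IsOpen W → W.Nonempty → IsSyndetic (returnSet T U W)

/-- The orbit `{x, T x, T² x, …}`. -/
def orbit (T : X → X) (x : X) : Set X := Set.range fun n : ℕ => T^[n] x

/-- Some orbit is dense. -/
def IsHypercyclic (T : X → X) : Prop := ∃ x : X, Dense (orbit T x)

/-- Some orbit is sequentially dense: every point is the limit of a sequence in the orbit. -/
def IsSeqHypercyclic (T : X → X) : Prop := ∃ x : X, seqClosure (orbit T x) = Set.univ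

/-- Transitive with a dense set of periodic points. -/
def IsChaotic (T : X → X) : Prop := IsTransitive T ∧ Dense (Function.periodicPts T)

end LinDyn

/-! ### Köthe coechelon spaces -/

namespace Kothe

/-- The exponents `p ∈ {0} ∪ [1, ∞)`. -/
abbrev Exponent : Type := {p : ℝ // p = 0 ∨ 1 ≤ p}

/-- The exponent in Mathlib's scale `ℓ^q` whose norm is used: `q = p` if `p ≥ 1`, and the sup norm
`q = ∞` for `p = 0`, i.e. on `c₀`. -/
noncomputable def Exponent.lpExp (p : Exponent) : ℝ≥0∞ :=
  if p.1 = 0 then ∞ else ENNReal.ofReal p.1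

instance (p : Exponent) : Fact (1 ≤ p.lpExp) := ⟨by
  unfold Exponent.lpExp
  split_ifs with h
  · exact le_top
  · exact ENNReal.one_le_ofReal.2 (p.2.resolve_left h)⟩

/-- `x ∈ ℓ_p` if `p ≥ 1`, and `x ∈ c₀` if `p = 0`. -/
def MemSeq {ι E : Type*} [NormedAddCommGroup E] (p : Exponent) (x : ι → E) : Prop :=
  if p.1 = 0 then Tendsto x cofinite (𝓝 0) else Memℓp x (ENNReal.ofReal p.1)

section MemSeq

variable {ι E : Type*} [NormedAddCommGroup E] {p : Exponent}

theorem MemSeq.memℓp {x : ι → E} (hx : MemSeq p x) : Memℓp x p.lpExp := by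
  unfold MemSeq at hx
  unfold Exponent.lpExp
  split_ifs at hx ⊢ with h
  · refine memℓp_infty ?_
    have h1 : ∀ᶠ i in cofinite, ‖x i‖ < 1 := by
      have := hx.norm
      rw [norm_zero] at this
      exact this.eventually (gt_mem_nhds one_pos)
    have h2 : {i | ¬ ‖x i‖ < 1}.Finite := h1
    refine ((h2.image fun i => ‖x i‖).bddAbove.union (bddAbove_Iic (a := (1 : ℝ)))).mono ?_
    rintro _ ⟨i, rfl⟩
    by_cases hi : ‖x i‖ < 1
    · exact Or.inr hi.le
    · exact Or.inl ⟨i, hi, rfl⟩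
  · exact hx

theorem MemSeq.zero : MemSeq p (0 : ι → E) := by
  unfold MemSeq
  split_ifs
  · exact tendsto_const_nhds
  · exact zero_memℓp

theorem MemSeq.add {x y : ι → E} (hx : MemSeq p x) (hy : MemSeq p y) : MemSeq p (x + y) := by
  unfold MemSeq at *
  split_ifs at *
  · have h := Tendsto.add hx hy
    rw [add_zero] at h
    exact h
  · exact Memℓp.add hx hy

theorem MemSeq.const_smul {𝕜 : Type*} [NormedField 𝕜] [NormedSpace 𝕜 E] {x : ι → E}
    (hx : MemSeq p x) (c : 𝕜) : MemSeq p (c • x) := by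
  unfold MemSeq at *
  split_ifs at *
  · have h := Tendsto.const_smul hx c
    rw [smul_zero] at h
    exact h
  · exact Memℓp.const_smul hx c

theorem MemSeq.mono {x y : ι → E} (hx : MemSeq p x) (hxy : ∀ i, ‖y i‖ ≤ ‖x i‖) :
    MemSeq p y := by
  unfold MemSeq at *
  split_ifs at *
  · exact squeeze_zero_norm hxy (by simpa using hx.norm)
  · exact (memℓp_norm_iff.2 hx).mono hxy

end MemSeq

/-- A decreasing sequence `V = (v^{(m)})_m` of strictly positive weights on `{1, 2, 3, …}`. -/
structure WeightSeq where
  /-- The weight `v^{(m)}_j`. -/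
  v : ℕ → ℕ+ → ℝ
  pos : ∀ m j, 0 < v m j
  anti : ∀ m j, v (m + 1) j ≤ v m j

theorem WeightSeq.le_of_le (V : WeightSeq) {m n : ℕ} (h : m ≤ n) (j : ℕ+) : V.v n j ≤ V.v m j :=
  antitone_nat_of_succ_le (f := fun k => V.v k j) (fun k => V.anti k j) h

section Spaces

variable (𝕜 : Type*) [RCLike 𝕜]

/-- The step space `ℓ_p(a)` (respectively `c₀(a)` if `p = 0`) of all scalar sequences `x` with
`(x_j a_j)_j` in `ℓ_p` (respectively in `c₀`). -/
def step (p : Exponent) (a : ℕ+ → ℝ) : Submodule 𝕜 (ℕ+ → 𝕜) where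
  carrier := {x | MemSeq p fun j => x j * (a j : 𝕜)}
  zero_mem' := by
    simpa [Pi.zero_def] using (MemSeq.zero : MemSeq p (0 : ℕ+ → 𝕜))
  add_mem' {x y} hx hy := by
    simpa [Pi.add_def, add_mul] using MemSeq.add hx hy
  smul_mem' c x hx := by
    simpa [Pi.smul_def, mul_assoc] using MemSeq.const_smul hx c

/-- The step space as a type of its own, which is to carry its norm topology (and not the topology
induced by the product topology). -/
def Step (p : Exponent) (a : ℕ+ → ℝ) : Type _ := ↥(step 𝕜 p a)

/-- The map `x ↦ (x_j a_j)_j` from the step space into `ℓ_p` (into `ℓ_∞` if `p = 0`). -/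
def stepEmb (p : Exponent) (a : ℕ+ → ℝ) (x : Step 𝕜 p a) : lp (fun _ : ℕ+ => 𝕜) p.lpExp :=
  ⟨fun j => x.1 j * (a j : 𝕜), MemSeq.memℓp x.2⟩

/-- The topology of the step space given by the norm `‖(x_j a_j)_j‖` of `ℓ_p`
(the sup norm if `p = 0`). -/
noncomputable instance stepTopology (p : Exponent) (a : ℕ+ → ℝ) :
    TopologicalSpace (Step 𝕜 p a) :=
  TopologicalSpace.induced (stepEmb 𝕜 p a) inferInstance

variable {𝕜} in
theorem step_mono {p : Exponent} (V : WeightSeq) {m n : ℕ} (h : m ≤ n) {x : ℕ+ → 𝕜}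
    (hx : x ∈ step 𝕜 p (V.v m)) : x ∈ step 𝕜 p (V.v n) := by
  refine MemSeq.mono hx fun j => ?_
  simp only [norm_mul, RCLike.norm_ofReal, abs_of_pos (V.pos _ _)]
  exact mul_le_mul_of_nonneg_left (V.le_of_le h j) (norm_nonneg _)

/-- The vector space `k_p(V)`, the union of the step spaces. -/
def coechelon (p : Exponent) (V : WeightSeq) : Submodule 𝕜 (ℕ+ → 𝕜) where
  carrier := {x | ∃ m : ℕ, x ∈ step 𝕜 p (V.v m)}
  zero_mem' := ⟨0, Submodule.zero_mem _⟩
  add_mem' := by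
    rintro x y ⟨m, hx⟩ ⟨n, hy⟩
    exact ⟨max m n, Submodule.add_mem _ (step_mono V (le_max_left m n) hx)
      (step_mono V (le_max_right m n) hy)⟩
  smul_mem' := by
    rintro c x ⟨m, hx⟩
    exact ⟨m, Submodule.smul_mem _ c hx⟩

/-- `k_p(V)` as a type of its own, which is to carry the inductive limit topology (and not the
topology induced by the product topology). -/
def Coechelon (p : Exponent) (V : WeightSeq) : Type _ := ↥(coechelon 𝕜 p V)

instance (p : Exponent) (V : WeightSeq) : AddCommGroup (Coechelon 𝕜 p V) :=
  inferInstanceAs (AddCommGroup ↥(coechelon 𝕜 p V))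

instance (p : Exponent) (V : WeightSeq) : Module 𝕜 (Coechelon 𝕜 p V) :=
  inferInstanceAs (Module 𝕜 ↥(coechelon 𝕜 p V))

noncomputable instance (p : Exponent) (V : WeightSeq) : Module ℝ (Coechelon 𝕜 p V) :=
  inferInstanceAs (Module ℝ ↥(coechelon 𝕜 p V))

instance (p : Exponent) (V : WeightSeq) : IsScalarTower ℝ 𝕜 (Coechelon 𝕜 p V) :=
  inferInstanceAs (IsScalarTower ℝ 𝕜 ↥(coechelon 𝕜 p V))

/-- The inclusion of the `m`-th step space into `k_p(V)`. -/
def stepIncl (p : Exponent) (V : WeightSeq) (m : ℕ) (x : Step 𝕜 p (V.v m)) : Coechelon 𝕜 p V :=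
  ⟨x.1, m, x.2⟩

/-- The inductive limit topology of `k_p(V)`: the finest locally convex vector space topology for
which the inclusions of all step spaces are continuous. (The infimum in Mathlib's order of
topologies of all such topologies; it is itself such a topology.) -/
instance coechelonTopology (p : Exponent) (V : WeightSeq) :
    TopologicalSpace (Coechelon 𝕜 p V) :=
  sInf {t | (∀ m : ℕ, Continuous[_, t] (stepIncl 𝕜 p V m)) ∧
    @IsTopologicalAddGroup (Coechelon 𝕜 p V) t _ ∧
    @ContinuousSMul 𝕜 (Coechelon 𝕜 p V) _ _ t ∧
    @LocallyConvexSpace ℝ (Coechelon 𝕜 p V) _ _ _ _ t}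

end Spaces

/-! ### Weighted generalized backward shifts -/

/-- A symbol: a bijection `ψ` from `{1, 2, 3, …}` onto `{2, 3, 4, …}` such that every positive
integer is `1` or of the form `ψ^n(1)` with `n ≥ 1`. -/
def IsSymbol (ψ : ℕ+ → ℕ+) : Prop :=
  Set.BijOn ψ Set.univ {1}ᶜ ∧ ∀ k : ℕ+, k = 1 ∨ ∃ n : ℕ, 1 ≤ n ∧ ψ^[n] 1 = k

section Shift

variable {𝕜 : Type*} [RCLike 𝕜]

/-- The weighted generalized backward shift `B_{w,ψ}` on the space of all sequences. -/
def backwardShift (w : ℕ+ → 𝕜) (ψ : ℕ+ → ℕ+) : (ℕ+ → 𝕜) →ₗ[𝕜] (ℕ+ → 𝕜) where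
  toFun x j := w (ψ j) * x (ψ j)
  map_add' x y := by ext j; simp [mul_add]
  map_smul' c x := by ext j; simp [mul_left_comm]

/-- The operator which `B_{w,ψ}` induces on `k_p(V)` if it leaves `k_p(V)` invariant. -/
def shiftOn (p : Exponent) (V : WeightSeq) (w : ℕ+ → 𝕜) (ψ : ℕ+ → ℕ+)
    (hB : ∀ x ∈ coechelon 𝕜 p V, backwardShift w ψ x ∈ coechelon 𝕜 p V) :
    Coechelon 𝕜 p V →ₗ[𝕜] Coechelon 𝕜 p V :=
  (backwardShift w ψ).restrict hB

/-- The quotient `v^{(m)}_{ψ^j(1)} / ∏_{l=0}^{j} |w_{ψ^l(1)}|`. -/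
noncomputable def quot (V : WeightSeq) (w : ℕ+ → 𝕜) (ψ : ℕ+ → ℕ+) (m j : ℕ) : ℝ :=
  V.v m (ψ^[j] 1) / ∏ l ∈ Finset.range (j + 1), ‖w (ψ^[l] 1)‖

end Shift

end Kothe

/-! In the coordinates `coord`, the operator is the unweighted backward shift and the `m`-th step
norm is an `ℓ_p`-norm (sup norm if `p = 0`) with weight `quot V w ψ m`. Everything therefore depends
on where these quotients are small. The inductive limit topology enters in two ways: linear maps
into normed spaces are continuous once they are so on steps (`continuous_of_step`), and convergence
in one step gives convergence in the limit (`tendsto_stepIncl_zero`).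

If `e_j` is small, then adding suitable shifts of `e_j` to a finite vector `u` moves `u` little, and
`j - d` shifts produce any prescribed finite vector (`exists_sub_mem_returnSet`). If the quotients
of every step are bounded below on `I`, the coordinates in `I` form a continuous map into `ℓ_∞(I)`,
which yields a return set missing `I` (`exists_returnSet_disjoint`). These two lemmas carry
transitivity, mixing and ergodicity.

A hypercyclic vector is built explicitly, by placing blocks at the ends of long windows of small
weights (`exists_block_sequence`); no Baire argument is used. Conversely, a dense orbit forces long
windows of large coordinates of a vector lying in one step. For periodic points, a period of shifts
dominates a constant sequence; in the other direction, bounded coordinate sequences all lie in the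
space, and periodizations of a finite vector converge to it. -/

namespace Kothe

/-! ### Norm estimates and dominated convergence in `ℓ_p` and `c₀` -/

section Sequences

variable {ι E : Type*} [NormedAddCommGroup E] {p : Exponent}

theorem Exponent.lpExp_ne_zero (p : Exponent) : p.lpExp ≠ 0 :=
  (zero_lt_one.trans_le (Fact.out : 1 ≤ p.lpExp)).ne'

theorem Exponent.one_le_of_ne_zero {p : Exponent} (h : p.1 ≠ 0) : 1 ≤ p.1 := p.2.resolve_left h

theorem Exponent.toReal_ofReal_of_ne_zero {p : Exponent} (h : p.1 ≠ 0) :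
    (ENNReal.ofReal p.1).toReal = p.1 :=
  ENNReal.toReal_ofReal (zero_le_one.trans (one_le_of_ne_zero h))

theorem Exponent.lpExp_of_ne_zero {p : Exponent} (h : p.1 ≠ 0) :
    p.lpExp = ENNReal.ofReal p.1 := if_neg h

theorem memSeq_iff_of_eq_zero (h : p.1 = 0) {x : ι → E} :
    MemSeq p x ↔ Tendsto x cofinite (𝓝 0) := by simp [MemSeq, h]

theorem memSeq_iff_of_ne_zero (h : p.1 ≠ 0) {x : ι → E} :
    MemSeq p x ↔ Summable fun i => ‖x i‖ ^ p.1 := by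
  have h1 := Exponent.one_le_of_ne_zero h
  rw [MemSeq, if_neg h, memℓp_gen_iff, Exponent.toReal_ofReal_of_ne_zero h]
  rw [Exponent.toReal_ofReal_of_ne_zero h]; linarith

theorem MemSeq.of_norm_le {F : Type*} [NormedAddCommGroup F] {x : ι → E} {y : ι → F}
    (hx : MemSeq p x) (hxy : ∀ i, ‖y i‖ ≤ ‖x i‖) : MemSeq p y := by
  by_cases h : p.1 = 0
  · rw [memSeq_iff_of_eq_zero h] at *
    exact squeeze_zero_norm hxy (by simpa using hx.norm)
  · rw [memSeq_iff_of_ne_zero h] at *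
    have h1 := Exponent.one_le_of_ne_zero h
    exact hx.of_nonneg_of_le (fun i => by positivity)
      fun i => Real.rpow_le_rpow (norm_nonneg _) (hxy i) (by linarith)

theorem MemSeq.comp_injective {κ : Type*} {x : ι → E} (hx : MemSeq p x) {f : κ → ι}
    (hf : Function.Injective f) : MemSeq p (x ∘ f) := by
  by_cases h : p.1 = 0
  · rw [memSeq_iff_of_eq_zero h] at *
    exact hx.comp hf.tendsto_cofinite
  · rw [memSeq_iff_of_ne_zero h] at *
    exact hx.comp_injective hf

theorem MemSeq.tendsto_zero {x : ι → E} (hx : MemSeq p x) : Tendsto x cofinite (𝓝 0) := by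
  by_cases h : p.1 = 0
  · rwa [memSeq_iff_of_eq_zero h] at hx
  · rw [memSeq_iff_of_ne_zero h] at hx
    have h1 := Exponent.one_le_of_ne_zero h
    have h2 := hx.tendsto_cofinite_zero.rpow_const (p := p.1⁻¹) (Or.inr (by positivity))
    rw [Real.zero_rpow (by positivity)] at h2
    refine tendsto_zero_iff_norm_tendsto_zero.2 (h2.congr fun i => ?_)
    rw [← Real.rpow_mul (norm_nonneg _), mul_inv_cancel₀ h, Real.rpow_one]

theorem MemSeq.of_summable_norm {x : ι → E} (hx : Summable fun i => ‖x i‖) : MemSeq p x := by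
  by_cases h : p.1 = 0
  · rw [memSeq_iff_of_eq_zero h]
    exact tendsto_zero_iff_norm_tendsto_zero.2 hx.tendsto_cofinite_zero
  · rw [MemSeq, if_neg h]
    refine Memℓp.of_exponent_ge (p := ENNReal.ofReal p.1) (q := 1) (memℓp_gen (by simpa using hx)) ?_
    exact ENNReal.one_le_ofReal.2 (Exponent.one_le_of_ne_zero h)

/-- With `S` the `ℓ_1`-norm, `‖x i‖ ^ p ≤ ‖x i‖ * S ^ (p - 1)`. Vectors can thus be made small in a
weighted `ℓ_1`-norm, for all exponents at once. -/
theorem norm_le_tsum_norm {x : ι → E} (hx : Summable fun i => ‖x i‖) (hm : Memℓp x p.lpExp) :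
    ‖(⟨x, hm⟩ : lp (fun _ : ι => E) p.lpExp)‖ ≤ ∑' i, ‖x i‖ := by
  have h0 : 0 ≤ ∑' i, ‖x i‖ := tsum_nonneg fun i => norm_nonneg _
  have hle : ∀ i, ‖x i‖ ≤ ∑' i, ‖x i‖ := fun i =>
    hx.le_tsum i fun j _ => norm_nonneg _
  by_cases h : p.1 = 0
  · have : p.lpExp = ∞ := if_pos h
    -- The exponent occurs in the type of the `lp` element, so it becomes a variable before `∞` is
    -- substituted.
    generalize p.lpExp = r at *
    subst this
    exact lp.norm_le_of_forall_le h0 hle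
  · have h1 := Exponent.one_le_of_ne_zero h
    have ht : p.lpExp.toReal = p.1 := by
      rw [Exponent.lpExp_of_ne_zero h, Exponent.toReal_ofReal_of_ne_zero h]
    refine lp.norm_le_of_forall_sum_le (by rw [ht]; linarith) h0 fun s => ?_
    rw [ht]
    set S := ∑' i, ‖x i‖
    rcases h0.eq_or_lt with hS | hS
    · refine (Finset.sum_nonpos fun i _ => ?_).trans (by positivity)
      have : ‖x i‖ = 0 := le_antisymm ((hle i).trans hS.ge) (norm_nonneg _)
      simp [this, Real.zero_rpow h]
    · calc ∑ i ∈ s, ‖x i‖ ^ p.1 ≤ ∑ i ∈ s, ‖x i‖ * S ^ (p.1 - 1) := by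
            refine Finset.sum_le_sum fun i _ => ?_
            rcases (norm_nonneg (x i)).eq_or_lt with hi | hi
            · rw [← hi, Real.zero_rpow h, zero_mul]
            · have : ‖x i‖ ^ p.1 = ‖x i‖ * ‖x i‖ ^ (p.1 - 1) := by
                rw [Real.rpow_sub_one hi.ne']; field_simp
              rw [this]
              gcongr
              · exact hle i
        _ = (∑ i ∈ s, ‖x i‖) * S ^ (p.1 - 1) := by rw [Finset.sum_mul]
        _ ≤ S * S ^ (p.1 - 1) := by
            gcongr
            exact hx.sum_le_tsum s fun i _ => norm_nonneg _
        _ = S ^ p.1 := by rw [Real.rpow_sub_one hS.ne']; field_simp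

/-- Dominated convergence in `ℓ_p` and in `c₀`. -/
theorem tendsto_norm_zero_of_dominated {α : Type*} {F : Filter α} {f : ι → E} (hf : MemSeq p f)
    {g : α → ι → E} (hg : ∀ a, Memℓp (g a) p.lpExp) (hgf : ∀ a i, ‖g a i‖ ≤ ‖f i‖)
    (hlim : ∀ i, Tendsto (fun a => g a i) F (𝓝 0)) :
    Tendsto (fun a => ‖(⟨g a, hg a⟩ : lp (fun _ : ι => E) p.lpExp)‖) F (𝓝 0) := by
  by_cases h : p.1 = 0
  · have hq : p.lpExp = ∞ := if_pos h
    rw [memSeq_iff_of_eq_zero h] at hf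
    generalize p.lpExp = r at *
    subst hq
    rw [Metric.tendsto_nhds]
    intro ε hε
    have hfin : {i | ¬ ‖f i‖ < ε / 2}.Finite := by
      have := hf.norm
      rw [norm_zero] at this
      exact this.eventually (gt_mem_nhds (half_pos hε))
    have hev : ∀ᶠ a in F, ∀ i ∈ {i | ¬ ‖f i‖ < ε / 2}, ‖g a i‖ < ε / 2 := by
      rw [eventually_all_finite hfin]
      intro i _
      have := (hlim i).norm
      rw [norm_zero] at this
      exact this.eventually (gt_mem_nhds (half_pos hε))
    filter_upwards [hev] with a ha
    rw [dist_zero_right, norm_norm]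
    refine (lp.norm_le_of_forall_le (half_pos hε).le fun i => ?_).trans_lt (half_lt_self hε)
    by_cases hi : ‖f i‖ < ε / 2
    · exact (hgf a i).trans hi.le
    · exact (ha i hi).le
  · have h1 := Exponent.one_le_of_ne_zero h
    have ht : p.lpExp.toReal = p.1 := by
      rw [Exponent.lpExp_of_ne_zero h, Exponent.toReal_ofReal_of_ne_zero h]
    rw [memSeq_iff_of_ne_zero h] at hf
    have hsum : Tendsto (fun a => ∑' i, ‖g a i‖ ^ p.1) F (𝓝 (∑' _ : ι, (0 : ℝ))) := by
      refine tendsto_tsum_of_dominated_convergence hf (fun i => ?_) (Eventually.of_forall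
        fun a i => ?_)
      · have h2 := (hlim i).norm.rpow_const (p := p.1) (Or.inr (by linarith))
        rwa [norm_zero, Real.zero_rpow h] at h2
      · rw [Real.norm_of_nonneg (by positivity)]
        exact Real.rpow_le_rpow (norm_nonneg _) (hgf a i) (by linarith)
    rw [tsum_zero] at hsum
    have h3 := hsum.rpow_const (p := 1 / p.1) (Or.inr (by positivity))
    rw [Real.zero_rpow (by positivity)] at h3
    refine h3.congr fun a => ?_
    rw [lp.norm_eq_tsum_rpow (by rw [ht]; linarith), ht]

end Sequences

/-! ### The inductive limit topology -/

section Topology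

variable {𝕜 : Type*} [RCLike 𝕜] {p : Exponent} {V : WeightSeq}

instance : IsTopologicalAddGroup (Coechelon 𝕜 p V) :=
  topologicalAddGroup_sInf fun _ ht => ht.2.1

instance : ContinuousSMul 𝕜 (Coechelon 𝕜 p V) :=
  continuousSMul_sInf fun _ ht => ht.2.2.1

theorem continuous_stepIncl (m : ℕ) : Continuous (stepIncl 𝕜 p V m) :=
  continuous_sInf_rng.2 fun _ ht => ht.1 m

/-- A linear map on `k_p(V)` with values in a normed space is continuous if it is so on all
steps. -/
theorem continuous_of_step {F : Type*} [NormedAddCommGroup F] [NormedSpace 𝕜 F]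
    (L : Coechelon 𝕜 p V →ₗ[𝕜] F)
    (hL : ∀ m, Continuous fun x : Step 𝕜 p (V.v m) => L (stepIncl 𝕜 p V m x)) :
    Continuous L := by
  let : NormedSpace ℝ F := NormedSpace.restrictScalars ℝ 𝕜 F
  have : IsScalarTower ℝ 𝕜 F := RestrictScalars.isScalarTower ℝ 𝕜 F
  rw [continuous_iff_le_induced]
  -- The topology induced by `L` is a locally convex vector space topology with continuous step
  -- inclusions, hence one of those whose infimum is taken.
  refine sInf_le ⟨fun m => continuous_induced_rng.2 (hL m), topologicalAddGroup_induced L,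
    continuousSMul_induced L, ?_⟩
  exact LocallyConvexSpace.induced (L.restrictScalars ℝ)

theorem continuous_of_step_norm_le {F : Type*} [NormedAddCommGroup F] [NormedSpace 𝕜 F]
    (L : Coechelon 𝕜 p V →ₗ[𝕜] F)
    (hL : ∀ m, ∃ C : ℝ, ∀ x : Step 𝕜 p (V.v m),
      ‖L (stepIncl 𝕜 p V m x)‖ ≤ C * ‖stepEmb 𝕜 p (V.v m) x‖) : Continuous L := by
  refine continuous_of_step L fun m => ?_
  obtain ⟨C, hC⟩ := hL m
  rw [continuous_iff_continuousAt]
  intro x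
  rw [ContinuousAt, tendsto_iff_norm_sub_tendsto_zero]
  have h1 : Tendsto (fun y => stepEmb 𝕜 p (V.v m) y) (𝓝 x) (𝓝 (stepEmb 𝕜 p (V.v m) x)) :=
    continuous_induced_dom.tendsto x
  rw [tendsto_iff_norm_sub_tendsto_zero] at h1
  have h2 := h1.const_mul C
  rw [mul_zero] at h2
  refine squeeze_zero (fun _ => norm_nonneg _) (fun y => ?_) h2
  let d : Step 𝕜 p (V.v m) := ⟨y.1 - x.1, Submodule.sub_mem _ y.2 x.2⟩
  have e1 : stepIncl 𝕜 p V m d = stepIncl 𝕜 p V m y - stepIncl 𝕜 p V m x := rfl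
  have e2 : stepEmb 𝕜 p (V.v m) d = stepEmb 𝕜 p (V.v m) y - stepEmb 𝕜 p (V.v m) x := by
    ext j
    exact sub_mul (y.1 j) (x.1 j) _
  rw [← map_sub, ← e1, ← e2]
  exact hC d

theorem tendsto_stepIncl_zero {α : Type*} {F : Filter α} {m : ℕ} {d : α → Step 𝕜 p (V.v m)}
    (hd : Tendsto (fun a => ‖stepEmb 𝕜 p (V.v m) (d a)‖) F (𝓝 0)) :
    Tendsto (fun a => stepIncl 𝕜 p V m (d a)) F (𝓝 0) := by
  let o : Step 𝕜 p (V.v m) := ⟨0, Submodule.zero_mem _⟩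
  have ho : stepEmb 𝕜 p (V.v m) o = 0 := by
    ext j
    exact zero_mul _
  have h1 : Tendsto d F (𝓝 o) := by
    rw [nhds_induced, tendsto_comap_iff, ho]
    exact tendsto_zero_iff_norm_tendsto_zero.2 hd
  exact ((continuous_stepIncl m).tendsto o).comp h1

end Topology

/-! ### Coordinates along the orbit of `1` -/

/-- The enumeration `j ↦ ψ^j(1)` of the positive integers. -/
noncomputable def IsSymbol.equiv {ψ : ℕ+ → ℕ+} (hψ : IsSymbol ψ) : ℕ ≃ ℕ+ :=
  Equiv.ofBijective (fun j => ψ^[j] 1) <| by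
    have hinj : Function.Injective ψ := fun a b h =>
      hψ.1.injOn (mem_univ a) (mem_univ b) h
    have hne : ∀ n, 0 < n → ψ^[n] 1 ≠ 1 := by
      intro n hn
      obtain ⟨k, rfl⟩ := Nat.exists_eq_add_of_lt hn
      rw [zero_add, Function.iterate_succ_apply']
      exact hψ.1.mapsTo (mem_univ _)
    -- Injectivity cancels `ψ^[a]`, leaving `ψ^[b - a] 1 = 1`, but `1` is not in the range of `ψ`.
    have hlt : ∀ a b, a < b → ψ^[a] 1 ≠ ψ^[b] 1 := by
      intro a b hab h
      refine hne (b - a) (Nat.sub_pos_of_lt hab) (hinj.iterate a ?_)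
      rw [← Function.iterate_add_apply, Nat.add_sub_cancel' hab.le, h]
    refine ⟨fun a b h => ?_, fun k => ?_⟩
    · rcases lt_trichotomy a b with hab | hab | hab
      · exact (hlt a b hab h).elim
      · exact hab
      · exact (hlt b a hab h.symm).elim
    · rcases hψ.2 k with rfl | ⟨n, -, hn⟩
      exacts [⟨0, rfl⟩, ⟨n, hn⟩]

theorem IsSymbol.equiv_apply {ψ : ℕ+ → ℕ+} (hψ : IsSymbol ψ) (j : ℕ) :
    hψ.equiv j = ψ^[j] 1 := rfl

variable {𝕜 : Type*} [RCLike 𝕜] {p : Exponent} {V : WeightSeq} {w : ℕ+ → 𝕜} {ψ : ℕ+ → ℕ+}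

/-- The product of the weights along the first `j + 1` points of the orbit of `1`. -/
def weightProd (w : ℕ+ → 𝕜) (ψ : ℕ+ → ℕ+) (j : ℕ) : 𝕜 :=
  ∏ l ∈ Finset.range (j + 1), w (ψ^[l] 1)

theorem weightProd_ne_zero (hw : ∀ j, w j ≠ 0) (j : ℕ) : weightProd w ψ j ≠ 0 :=
  Finset.prod_ne_zero_iff.2 fun _ _ => hw _

theorem weightProd_succ (j : ℕ) :
    weightProd w ψ (j + 1) = weightProd w ψ j * w (ψ^[j + 1] 1) :=
  Finset.prod_range_succ _ _

theorem quot_eq (m j : ℕ) : quot V w ψ m j = V.v m (ψ^[j] 1) / ‖weightProd w ψ j‖ := by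
  rw [quot, weightProd, norm_prod]

theorem quot_pos (hw : ∀ j, w j ≠ 0) (m j : ℕ) : 0 < quot V w ψ m j := by
  rw [quot_eq]
  exact div_pos (V.pos _ _) (norm_pos_iff.2 (weightProd_ne_zero hw j))

theorem quot_anti (w : ℕ+ → 𝕜) (ψ : ℕ+ → ℕ+) {m n : ℕ} (h : m ≤ n) (j : ℕ) :
    quot V w ψ n j ≤ quot V w ψ m j := by
  rw [quot_eq, quot_eq]
  gcongr
  exact V.le_of_le h _

/-- The coordinates in which `B_{w,ψ}` is the unweighted backward shift. -/
noncomputable def coord (p : Exponent) (V : WeightSeq) (w : ℕ+ → 𝕜) (ψ : ℕ+ → ℕ+) (j : ℕ) :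
    Coechelon 𝕜 p V →ₗ[𝕜] 𝕜 where
  toFun x := weightProd w ψ j * x.1 (ψ^[j] 1)
  map_add' x y := mul_add _ (x.1 _) (y.1 _)
  map_smul' c x := mul_left_comm _ c (x.1 _)

theorem coord_apply (x : Coechelon 𝕜 p V) (j : ℕ) :
    coord p V w ψ j x = weightProd w ψ j * x.1 (ψ^[j] 1) := rfl

theorem apply_eq_coord_div (hw : ∀ j, w j ≠ 0) (x : Coechelon 𝕜 p V) (j : ℕ) :
    x.1 (ψ^[j] 1) = coord p V w ψ j x / weightProd w ψ j := by
  rw [coord_apply, mul_div_cancel_left₀ _ (weightProd_ne_zero hw j)]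

/-- This identifies the `m`-th step norm as a weighted norm of the coordinates, with weight `quot V
w ψ m`. -/
theorem norm_coord_mul_quot (hw : ∀ j, w j ≠ 0) (x : Coechelon 𝕜 p V) (m j : ℕ) :
    ‖coord p V w ψ j x‖ * quot V w ψ m j = ‖x.1 (ψ^[j] 1) * (V.v m (ψ^[j] 1) : 𝕜)‖ := by
  have := norm_ne_zero_iff.2 (weightProd_ne_zero (ψ := ψ) hw j)
  rw [coord_apply, quot_eq, norm_mul, norm_mul, RCLike.norm_ofReal, abs_of_pos (V.pos _ _)]
  field_simp

theorem ext_coord (hw : ∀ j, w j ≠ 0) (hψ : IsSymbol ψ) {x y : Coechelon 𝕜 p V}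
    (h : ∀ j, coord p V w ψ j x = coord p V w ψ j y) : x = y := by
  refine Subtype.ext (funext fun i => ?_)
  obtain ⟨j, rfl⟩ := hψ.equiv.surjective i
  rw [hψ.equiv_apply, apply_eq_coord_div hw, apply_eq_coord_div hw, h]

theorem norm_coord_le (hw : ∀ j, w j ≠ 0) (m j : ℕ) (x : Step 𝕜 p (V.v m)) :
    ‖coord p V w ψ j (stepIncl 𝕜 p V m x)‖ ≤
      (quot V w ψ m j)⁻¹ * ‖stepEmb 𝕜 p (V.v m) x‖ := by
  rw [← div_eq_inv_mul, le_div_iff₀ (quot_pos hw m j), norm_coord_mul_quot hw]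
  exact lp.norm_apply_le_norm p.lpExp_ne_zero (stepEmb 𝕜 p (V.v m) x) (ψ^[j] 1)

theorem continuous_coord (hw : ∀ j, w j ≠ 0) (j : ℕ) : Continuous (coord p V w ψ j) :=
  continuous_of_step_norm_le _ fun m => ⟨_, norm_coord_le hw m j⟩

/-- The weight picked up by the shift is exactly the new factor of `weightProd` at `j + 1`. -/
theorem coord_shiftOn (hB : ∀ x ∈ coechelon 𝕜 p V, backwardShift w ψ x ∈ coechelon 𝕜 p V)
    (x : Coechelon 𝕜 p V) (j : ℕ) :
    coord p V w ψ j (shiftOn p V w ψ hB x) = coord p V w ψ (j + 1) x := by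
  rw [coord_apply, coord_apply, weightProd_succ, Function.iterate_succ_apply', mul_assoc]
  rfl

theorem coord_iterate_shiftOn
    (hB : ∀ x ∈ coechelon 𝕜 p V, backwardShift w ψ x ∈ coechelon 𝕜 p V) (n : ℕ)
    (x : Coechelon 𝕜 p V) (j : ℕ) :
    coord p V w ψ j ((shiftOn p V w ψ hB)^[n] x) = coord p V w ψ (j + n) x := by
  induction n generalizing j with
  | zero => rfl
  | succ n ih =>
    rw [Function.iterate_succ_apply', coord_shiftOn, ih, add_right_comm, add_assoc]

/-- The step in which an element lies, in coordinates. -/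
theorem exists_memSeq_coord (hw : ∀ j, w j ≠ 0) (hψ : IsSymbol ψ) (x : Coechelon 𝕜 p V) :
    ∃ m, MemSeq p fun j => ‖coord p V w ψ j x‖ * quot V w ψ m j := by
  obtain ⟨m, hm⟩ := x.2
  refine ⟨m, (MemSeq.comp_injective hm hψ.equiv.injective).of_norm_le fun j => ?_⟩
  rw [norm_coord_mul_quot hw, norm_norm]
  rfl

theorem exists_coord_eq (hw : ∀ j, w j ≠ 0) (hψ : IsSymbol ψ) {z : ℕ → 𝕜} {m : ℕ}
    (hz : MemSeq p fun j => ‖z j‖ * quot V w ψ m j) :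
    ∃ x : Coechelon 𝕜 p V, ∀ j, coord p V w ψ j x = z j := by
  refine ⟨⟨fun i => z (hψ.equiv.symm i) / weightProd w ψ (hψ.equiv.symm i), m, ?_⟩, fun j => ?_⟩
  · refine (hz.comp_injective hψ.equiv.symm.injective).of_norm_le fun i => ?_
    obtain ⟨j, rfl⟩ := hψ.equiv.surjective i
    simp only [Function.comp_apply, Equiv.symm_apply_apply]
    rw [quot_eq, norm_mul, norm_mul, norm_div, norm_div, norm_norm, norm_norm,
      RCLike.norm_ofReal, hψ.equiv_apply, Real.norm_eq_abs]
    exact le_of_eq (by ring)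
  · have := weightProd_ne_zero (ψ := ψ) hw j
    have h2 : hψ.equiv.symm (ψ^[j] 1) = j := hψ.equiv.symm_apply_apply j
    change weightProd w ψ j * (z (hψ.equiv.symm (ψ^[j] 1)) /
      weightProd w ψ (hψ.equiv.symm (ψ^[j] 1))) = z j
    rw [h2]
    field_simp

/-! ### Convergence and neighbourhoods of `0` in coordinates -/

/-- Dominated convergence in `k_p(V)`. -/
theorem tendsto_of_dominated (hw : ∀ j, w j ≠ 0) (hψ : IsSymbol ψ) {α : Type*} {F : Filter α}
    {g : α → Coechelon 𝕜 p V} {y f : Coechelon 𝕜 p V}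
    (hgf : ∀ a j, ‖coord p V w ψ j (g a) - coord p V w ψ j y‖ ≤ ‖coord p V w ψ j f‖)
    (hlim : ∀ j, Tendsto (fun a => coord p V w ψ j (g a)) F (𝓝 (coord p V w ψ j y))) :
    Tendsto g F (𝓝 y) := by
  obtain ⟨m, hm⟩ := f.2
  have key : ∀ a i, ‖((g a).1 i - y.1 i) * (V.v m i : 𝕜)‖ ≤ ‖f.1 i * (V.v m i : 𝕜)‖ := by
    intro a i
    obtain ⟨j, rfl⟩ := hψ.equiv.surjective i
    rw [hψ.equiv_apply, norm_mul, norm_mul, apply_eq_coord_div hw, apply_eq_coord_div hw,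
      apply_eq_coord_div hw, ← sub_div, norm_div, norm_div]
    gcongr
    exact hgf a j
  -- The differences all lie in the step of `f`, even if `g a` and `y` lie only in larger ones.
  let d : α → Step 𝕜 p (V.v m) := fun a => ⟨(g a).1 - y.1, hm.of_norm_le (key a)⟩
  have hd : Tendsto (fun a => stepIncl 𝕜 p V m (d a)) F (𝓝 0) := by
    refine tendsto_stepIncl_zero (tendsto_norm_zero_of_dominated hm _ key fun i => ?_)
    obtain ⟨j, rfl⟩ := hψ.equiv.surjective i
    have h1 := (((hlim j).sub_const (coord p V w ψ j y)).div_const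
      (weightProd w ψ j)).mul_const (V.v m (ψ^[j] 1) : 𝕜)
    rw [sub_self, zero_div, zero_mul] at h1
    refine h1.congr fun a => ?_
    simp only [d, hψ.equiv_apply, Pi.sub_apply]
    rw [apply_eq_coord_div hw, apply_eq_coord_div hw, sub_div]
  have := hd.add_const y
  rw [zero_add] at this
  refine this.congr fun a => ?_
  exact Subtype.ext (sub_add_cancel (g a).1 y.1)

/-- Neighbourhoods of `0` in `k_p(V)` contain small balls of weighted `ℓ_1`-norms. -/
theorem exists_ball_subset (hw : ∀ j, w j ≠ 0) (hψ : IsSymbol ψ) {O : Set (Coechelon 𝕜 p V)}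
    (hO : O ∈ 𝓝 (0 : Coechelon 𝕜 p V)) (m : ℕ) :
    ∃ δ : ℝ, 0 < δ ∧ ∀ x : Coechelon 𝕜 p V,
      Summable (fun j => ‖coord p V w ψ j x‖ * quot V w ψ m j) →
      ∑' j, ‖coord p V w ψ j x‖ * quot V w ψ m j < δ → x ∈ O := by
  have hF : Tendsto (stepIncl 𝕜 p V m)
      (comap (fun d => ‖stepEmb 𝕜 p (V.v m) d‖) (𝓝 0)) (𝓝 0) :=
    tendsto_stepIncl_zero (d := id) tendsto_comap
  obtain ⟨δ, hδ, hball⟩ := (((Metric.nhds_basis_ball (x := (0 : ℝ))).comap _).mem_iff).1 (hF hO)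
  refine ⟨δ, hδ, fun x hx hxδ => ?_⟩
  simp only [norm_coord_mul_quot hw] at hx hxδ
  have hx' : Summable fun i => ‖x.1 i * (V.v m i : 𝕜)‖ := hψ.equiv.summable_iff.1 hx
  have htsum := hψ.equiv.tsum_eq fun i => ‖x.1 i * (V.v m i : 𝕜)‖
  let d : Step 𝕜 p (V.v m) := ⟨x.1, MemSeq.of_summable_norm hx'⟩
  have hd : d ∈ (fun d => ‖stepEmb 𝕜 p (V.v m) d‖) ⁻¹' Metric.ball 0 δ := by
    rw [mem_preimage, mem_ball_zero_iff, norm_norm]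
    exact (norm_le_tsum_norm hx' _).trans_lt (htsum.symm.trans_lt hxδ)
  exact hball hd

/-! ### Lower limits of the quotients -/

theorem liminf_eq_zero_iff {α : Type*} {F : Filter α} {f : α → ℝ} (hf : ∀ a, 0 ≤ f a) :
    liminf (fun a => (f a : EReal)) F = 0 ↔ ∀ ε : ℝ, 0 < ε → ∃ᶠ a in F, f a < ε := by
  constructor
  · intro h ε hε hn
    have h1 : ((ε : ℝ) : EReal) ≤ liminf (fun a => (f a : EReal)) F :=
      le_liminf_of_le (h := by simpa using hn)
    rw [h] at h1
    exact absurd (EReal.coe_le_coe_iff.1 h1) (not_le.2 hε)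
  · intro h
    refine le_antisymm (EReal.le_of_forall_lt_iff_le.1 fun ε hε => ?_)
      (le_liminf_of_le (h := Eventually.of_forall fun a => EReal.coe_nonneg.2 (hf a)))
    exact liminf_le_of_frequently_le' ((h ε (EReal.coe_pos.1 hε)).mono fun a ha =>
      EReal.coe_le_coe_iff.2 ha.le)

/-- Values of a positive sequence whose lower limit is not zero are bounded below. -/
theorem exists_forall_le_of_liminf_ne_zero {f : ℕ → ℝ} (hf : ∀ j, 0 < f j) {I : Set ℕ}
    (h : liminf (fun j => (f j : EReal)) (atTop ⊓ 𝓟 I) ≠ 0) :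
    ∃ δ : ℝ, 0 < δ ∧ ∀ j ∈ I, δ ≤ f j := by
  rw [Ne, liminf_eq_zero_iff fun j => (hf j).le] at h
  push Not at h
  obtain ⟨ε, hε, h⟩ := h
  rw [eventually_inf_principal] at h
  obtain ⟨N, hN⟩ := eventually_atTop.1 h
  obtain ⟨δ, hδ, hδ'⟩ : ∃ δ : ℝ, 0 < δ ∧ ∀ j < N, δ ≤ f j := by
    clear hN
    induction N with
    | zero => exact ⟨1, one_pos, fun j hj => absurd hj (Nat.not_lt_zero _)⟩
    | succ N ih =>
      obtain ⟨δ, hδ, hδ'⟩ := ih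
      refine ⟨min δ (f N), lt_min hδ (hf N), fun j hj => ?_⟩
      rcases Nat.lt_succ_iff_lt_or_eq.1 hj with hj | rfl
      · exact (min_le_left _ _).trans (hδ' j hj)
      · exact min_le_right _ _
  refine ⟨min ε δ, lt_min hε hδ, fun j hj => ?_⟩
  rcases lt_or_ge j N with hjN | hjN
  · exact (min_le_right _ _).trans (hδ' j hjN)
  · exact (min_le_left _ _).trans (hN j hjN hj)

/-! ### Finite vectors and their density -/

theorem exists_coord_eq_of_finite (hw : ∀ j, w j ≠ 0) (hψ : IsSymbol ψ) {z : ℕ → 𝕜} {D : ℕ}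
    (hz : ∀ j, D ≤ j → z j = 0) :
    ∃ x : Coechelon 𝕜 p V, ∀ j, coord p V w ψ j x = z j := by
  refine exists_coord_eq hw hψ (m := 0) (MemSeq.of_summable_norm ?_)
  refine summable_of_ne_finset_zero (s := Finset.range D) fun j hj => ?_
  rw [hz j (by simpa using hj), norm_zero, zero_mul, norm_zero]

theorem exists_unit (hw : ∀ j, w j ≠ 0) (hψ : IsSymbol ψ) (j : ℕ) :
    ∃ e : Coechelon 𝕜 p V, ∀ i, coord p V w ψ i e = if i = j then 1 else 0 :=
  exists_coord_eq_of_finite hw hψ (D := j + 1) fun i hi => if_neg (by omega)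

/-- The first `a` coordinates approximate, with values in a dense set, by an error that is
dominated by the given element. -/
theorem exists_seq_tendsto (hw : ∀ j, w j ≠ 0) (hψ : IsSymbol ψ) {s : ℕ → 𝕜} (hs0 : s 0 = 0)
    (hs : DenseRange s) (y : Coechelon 𝕜 p V) :
    ∃ (b : ℕ → ℕ →₀ ℕ) (g : ℕ → Coechelon 𝕜 p V),
      (∀ a j, coord p V w ψ j (g a) = s (b a j)) ∧ Tendsto g atTop (𝓝 y) := by
  -- The bound `1 / (a + 1)` gives convergence of each coordinate, the bound by the coordinate of
  -- `y` gives domination by `y`. A zero coordinate is matched exactly because `s 0 = 0`.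
  have hc : ∀ a j : ℕ, ∃ k : ℕ,
      ‖s k - coord p V w ψ j y‖ ≤ min (1 / ((a : ℝ) + 1)) ‖coord p V w ψ j y‖ := by
    intro a j
    by_cases h : coord p V w ψ j y = 0
    · exact ⟨0, by simp [h, hs0]; positivity⟩
    · have hpos : 0 < min (1 / ((a : ℝ) + 1)) ‖coord p V w ψ j y‖ :=
        lt_min (by positivity) (norm_pos_iff.2 h)
      obtain ⟨k, hk⟩ := hs.exists_dist_lt (coord p V w ψ j y) hpos
      exact ⟨k, by rw [← dist_eq_norm, dist_comm]; exact hk.le⟩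
  choose c hcd using hc
  -- The approximants are recorded by indices into `s`: the type `ℕ →₀ ℕ` is countable, so all of
  -- them can later be enumerated.
  let b : ℕ → ℕ →₀ ℕ := fun a =>
    Finsupp.onFinset (Finset.range a) (fun j => if j < a then c a j else 0)
      (fun j hj => by by_contra h; exact hj (if_neg (by simpa using h)))
  have hb : ∀ a j, b a j = if j < a then c a j else 0 := fun a j => rfl
  have hx : ∀ a, ∃ x : Coechelon 𝕜 p V, ∀ j, coord p V w ψ j x = s (b a j) := fun a =>
    exists_coord_eq_of_finite hw hψ (D := a) fun j hj => by
      rw [hb, if_neg (by omega), hs0]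
  choose g hg using hx
  refine ⟨b, g, hg, tendsto_of_dominated hw hψ (f := y) (fun a j => ?_) fun j => ?_⟩
  · rw [hg, hb]
    split_ifs
    · exact (hcd a j).trans (min_le_right _ _)
    · rw [hs0, zero_sub, norm_neg]
  · rw [tendsto_iff_norm_sub_tendsto_zero]
    refine squeeze_zero' (Eventually.of_forall fun _ => norm_nonneg _) ?_
      (tendsto_one_div_add_atTop_nhds_zero_nat (𝕜 := ℝ))
    filter_upwards [eventually_gt_atTop j] with a ha
    rw [hg, hb, if_pos ha]
    exact (hcd a j).trans (min_le_left _ _)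

theorem exists_dense_seq_zero (𝕜 : Type*) [RCLike 𝕜] : ∃ s : ℕ → 𝕜, s 0 = 0 ∧ DenseRange s := by
  refine ⟨fun k => Nat.casesOn k 0 (TopologicalSpace.denseSeq 𝕜), rfl, ?_⟩
  refine (TopologicalSpace.denseRange_denseSeq 𝕜).mono ?_
  rintro _ ⟨k, rfl⟩
  exact ⟨k + 1, rfl⟩

theorem exists_finite_mem_of_isOpen (hw : ∀ j, w j ≠ 0) (hψ : IsSymbol ψ)
    {U : Set (Coechelon 𝕜 p V)} (hU : IsOpen U) (hne : U.Nonempty) :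
    ∃ u ∈ U, ∃ D : ℕ, ∀ j, D ≤ j → coord p V w ψ j u = 0 := by
  obtain ⟨y, hy⟩ := hne
  obtain ⟨s, hs0, hs⟩ := exists_dense_seq_zero 𝕜
  obtain ⟨b, g, hg, hlim⟩ := exists_seq_tendsto hw hψ hs0 hs y
  obtain ⟨a, ha⟩ := (hlim.eventually (hU.mem_nhds hy)).exists
  refine ⟨g a, ha, (b a).support.sup id + 1, fun j hj => ?_⟩
  rw [hg, Finsupp.notMem_support_iff.1, hs0]
  intro h
  have : j ≤ (b a).support.sup id := Finset.le_sup (f := id) h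
  omega

/-! ### Return sets -/

/-- Return sets contain a translate of the set of indices of small unit vectors. -/
theorem exists_sub_mem_returnSet (hw : ∀ j, w j ≠ 0) (hψ : IsSymbol ψ)
    {hB : ∀ x ∈ coechelon 𝕜 p V, backwardShift w ψ x ∈ coechelon 𝕜 p V}
    (hcont : Continuous (shiftOn p V w ψ hB)) {U W : Set (Coechelon 𝕜 p V)}
    (hU : IsOpen U) (hUne : U.Nonempty) (hW : IsOpen W) (hWne : W.Nonempty) :
    ∃ d N : ℕ, ∀ m, ∃ δ : ℝ, 0 < δ ∧ ∀ j, N ≤ j → quot V w ψ m j < δ →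
      j - d ∈ LinDyn.returnSet (shiftOn p V w ψ hB) U W := by
  obtain ⟨u, hu, D, hD⟩ := exists_finite_mem_of_isOpen hw hψ hU hUne
  obtain ⟨v, hv, d, hd⟩ := exists_finite_mem_of_isOpen hw hψ hW hWne
  let T := shiftOn p V w ψ hB
  -- For `s = e_j`, applying `T^[j - d]` turns the `i`-th summand into `v_i T^[j - i] e_j = v_i
  -- e_i`, so that `R e_j` is sent to `v`.
  let R : Coechelon 𝕜 p V → Coechelon 𝕜 p V := fun s =>
    ∑ i ∈ Finset.range d, coord p V w ψ i v • T^[d - i] s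
  have hT0 : ∀ n, T^[n] 0 = 0 := fun n => Function.iterate_fixed (map_zero T) n
  have hR0 : u + R 0 = u := by simp [R, hT0]
  have hR : Continuous fun s => u + R s := by
    refine continuous_const.add (continuous_finsetSum _ fun i _ => ?_)
    exact (hcont.iterate (d - i)).const_smul (coord p V w ψ i v)
  have hO : (fun s => u + R s) ⁻¹' U ∈ 𝓝 (0 : Coechelon 𝕜 p V) :=
    hR.continuousAt.preimage_mem_nhds (hU.mem_nhds (by rwa [hR0]))
  -- For `j > D + d`, the power `j - d` is positive and annihilates `u`. Both `d` and the bound are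
  -- chosen before `m`, which mixing needs, as there `m` depends on the index set.
  refine ⟨d, D + d + 1, fun m => ?_⟩
  obtain ⟨δ, hδ, hball⟩ := exists_ball_subset hw hψ hO m
  refine ⟨δ, hδ, fun j hj hjδ => ⟨by omega, ?_⟩⟩
  obtain ⟨e, he⟩ := exists_unit (p := p) (V := V) hw hψ j
  have hz : ∀ i, i ≠ j → ‖coord p V w ψ i e‖ * quot V w ψ m i = 0 := fun i hi => by
    rw [he, if_neg hi, norm_zero, zero_mul]
  have heU : u + R e ∈ U := by
    refine hball e (summable_of_ne_finset_zero (s := {j}) fun i hi => hz i (by simpa using hi)) ?_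
    rwa [tsum_eq_single j hz, he, if_pos rfl, norm_one, one_mul]
  refine ⟨v, ⟨u + R e, heU, ?_⟩, hv⟩
  refine ext_coord hw hψ fun k => ?_
  rw [coord_iterate_shiftOn, map_add, hD _ (by omega), zero_add, map_sum]
  have hterm : ∀ i ∈ Finset.range d, coord p V w ψ (k + (j - d))
      (coord p V w ψ i v • T^[d - i] e) = if i = k then coord p V w ψ k v else 0 := by
    intro i hi
    have hi := Finset.mem_range.1 hi
    rw [map_smul, coord_iterate_shiftOn, he, smul_eq_mul]
    by_cases h : i = k
    · rw [if_pos h, if_pos (by omega), mul_one, h]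
    · rw [if_neg h, if_neg (by omega), mul_zero]
  rw [Finset.sum_congr rfl hterm, Finset.sum_ite_eq']
  split_ifs with h
  · rfl
  · exact (hd k (by simpa using h)).symm

/-- If the quotients of every step are bounded away from zero on `I`, then some return set
misses `I`. -/
theorem exists_returnSet_disjoint (hw : ∀ j, w j ≠ 0) (hψ : IsSymbol ψ)
    (hB : ∀ x ∈ coechelon 𝕜 p V, backwardShift w ψ x ∈ coechelon 𝕜 p V) {I : Set ℕ}
    (h : ∀ m, ∃ δ : ℝ, 0 < δ ∧ ∀ j ∈ I, δ ≤ quot V w ψ m j) :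
    ∃ U W : Set (Coechelon 𝕜 p V), IsOpen U ∧ U.Nonempty ∧ IsOpen W ∧ W.Nonempty ∧
      ∀ n ∈ I, n ∉ LinDyn.returnSet (shiftOn p V w ψ hB) U W := by
  have hstep : ∀ m (δ : ℝ), 0 < δ → (∀ j ∈ I, δ ≤ quot V w ψ m j) →
      ∀ (x : Step 𝕜 p (V.v m)), ∀ j ∈ I, ‖coord p V w ψ j (stepIncl 𝕜 p V m x)‖ ≤
        δ⁻¹ * ‖stepEmb 𝕜 p (V.v m) x‖ := by
    intro m δ hδ hI x j hj
    refine (norm_coord_le hw m j x).trans ?_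
    gcongr
    exact hI j hj
  have hmem : ∀ x : Coechelon 𝕜 p V, Memℓp (fun j : I => coord p V w ψ j x) ∞ := by
    rintro ⟨x, m, hx⟩
    obtain ⟨δ, hδ, hI⟩ := h m
    refine memℓp_infty ⟨δ⁻¹ * ‖stepEmb 𝕜 p (V.v m) ⟨x, hx⟩‖, ?_⟩
    rintro _ ⟨j, rfl⟩
    exact hstep m δ hδ hI ⟨x, hx⟩ j j.2
  let L : Coechelon 𝕜 p V →ₗ[𝕜] lp (fun _ : I => 𝕜) ∞ :=
    { toFun := fun x => ⟨fun j => coord p V w ψ j x, hmem x⟩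
      map_add' := fun x y => by ext j; exact map_add _ _ _
      map_smul' := fun c x => by ext j; exact map_smul _ _ _ }
  have hL : Continuous L := continuous_of_step_norm_le L fun m => by
    obtain ⟨δ, hδ, hI⟩ := h m
    refine ⟨δ⁻¹, fun x => lp.norm_le_of_forall_le (by positivity) fun j => ?_⟩
    exact hstep m δ hδ hI x j j.2
  obtain ⟨e, he⟩ := exists_unit (p := p) (V := V) hw hψ 0
  -- If `T^[n] x` is in the second set, the `n`-th coordinate of `x` exceeds `1` in norm; for `n ∈
  -- I` it is bounded by `‖L x‖ < 1`.
  refine ⟨{x | ‖L x‖ < 1}, {x | 1 < ‖coord p V w ψ 0 x‖},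
    isOpen_lt hL.norm continuous_const, ⟨0, by simp⟩,
    isOpen_lt continuous_const (continuous_coord hw 0).norm, ⟨(2 : 𝕜) • e, ?_⟩, ?_⟩
  · simp [he]
  · rintro n hn ⟨-, _, ⟨x, hx, rfl⟩, hx'⟩
    have h1 : ‖coord p V w ψ n x‖ ≤ ‖L x‖ :=
      lp.norm_apply_le_norm ENNReal.top_ne_zero (L x) ⟨n, hn⟩
    rw [mem_ofPred_eq, coord_iterate_shiftOn, zero_add] at hx'
    exact absurd (hx'.trans_le h1) (not_lt.2 (le_of_lt hx))

/-! ### Hypercyclicity and thick sets -/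

/-- Double sums can be interchanged freely in `ℝ≥0∞`; summability and the real bound are recovered
together at the end. -/
theorem summable_and_tsum_le_of_ofReal {ι : Type*} {a : ι → ℝ} (ha : ∀ i, 0 ≤ a i) {C : ℝ}
    (hC : 0 ≤ C) (h : ∑' i, ENNReal.ofReal (a i) ≤ ENNReal.ofReal C) :
    Summable a ∧ ∑' i, a i ≤ C := by
  have key : ∀ s : Finset ι, ∑ i ∈ s, a i ≤ C := fun s => by
    have h1 := (ENNReal.sum_le_tsum s).trans h
    rw [← ENNReal.ofReal_sum_of_nonneg fun i _ => ha i] at h1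
    exact (ENNReal.ofReal_le_ofReal_iff hC).1 h1
  exact ⟨summable_of_sum_le ha key, Real.tsum_le_of_sum_le ha key⟩

/-- Blocks `y l`, supported in `[0, D l)`, can be placed at positions `n l` in such a way that
every shift `S^{n k}` of the resulting sequence `z` is close to `y k` in the `ℓ_1`-norm with weight
`c`, provided that `c` is small on arbitrarily long windows. -/
theorem exists_block_sequence {E : Type*} [NormedAddCommGroup E] {c : ℕ → ℝ} (hc : ∀ j, 0 ≤ c j)
    (hwin : ∀ ε : ℝ, 0 < ε → ∀ N L : ℕ, ∃ s, N ≤ s ∧ ∀ i ≤ L, c (s + i) < ε)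
    {y : ℕ → ℕ → E} {D : ℕ → ℕ} (hD : ∀ l j, D l ≤ j → y l j = 0) :
    ∃ (n : ℕ → ℕ) (z : ℕ → E), n 0 = 0 ∧ ∀ k,
      Summable (fun j => ‖z (j + n k) - y k j‖ * c j) ∧
        ∑' j, ‖z (j + n k) - y k j‖ * c j ≤ 2 * (1 / 2 : ℝ) ^ k := by
  let M : ℕ → ℝ := fun l => ∑ i ∈ Finset.range (D l), ‖y l i‖
  have hM : ∀ l, 0 ≤ M l := fun l => Finset.sum_nonneg fun _ _ => norm_nonneg _
  -- Block `l` has norm sum `M l`, so under weights below `ε l` it costs at most `4^{-l}`. This is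
  -- at most `2^{-k} 2^{-l}` for `l > k`, and summing over `l` gives the constant `2`.
  let ε : ℕ → ℝ := fun l => (1 / 2 : ℝ) ^ l * (1 / 2 : ℝ) ^ l / (M l + 1)
  have hε : ∀ l, 0 < ε l := fun l => div_pos (by positivity) (by linarith [hM l])
  choose σ hσ hσc using fun l N L => hwin (ε l) (hε l) N L
  -- The offset is at least `D l + 1`, which separates the blocks. The window has length `n l + D (l
  -- + 1)`, so that block `l + 1` still sees small weights after `n k` shifts, for every `k ≤ l`.
  let n : ℕ → ℕ := fun l =>
    Nat.rec (motive := fun _ => ℕ) 0 (fun l a => a + σ (l + 1) (D l + 1) (a + D (l + 1))) l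
  have hn0 : n 0 = 0 := rfl
  have hns : ∀ l, n (l + 1) = n l + σ (l + 1) (D l + 1) (n l + D (l + 1)) := fun l => rfl
  have hnD : ∀ l, n l + D l < n (l + 1) := fun l => by
    have := hσ (l + 1) (D l + 1) (n l + D (l + 1))
    rw [hns]; omega
  have hmono : StrictMono n := strictMono_nat_of_lt_succ fun l => by have := hnD l; omega
  have hlt : ∀ l k, l < k → n l + D l < n k := fun l k h =>
    (hnD l).trans_le (hmono.monotone h)
  have hsmall : ∀ k l i, k < l → i < D l → c (n l - n k + i) < ε l := by
    intro k l i hkl hi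
    obtain ⟨l, rfl⟩ : ∃ l', l = l' + 1 := ⟨l - 1, by omega⟩
    have h1 : n k ≤ n l := hmono.monotone (by omega)
    have h2 := hσc (l + 1) (D l + 1) (n l + D (l + 1)) (n l - n k + i) (by omega)
    have h3 := hns l
    rwa [show n (l + 1) - n k + i =
      σ (l + 1) (D l + 1) (n l + D (l + 1)) + (n l - n k + i) by omega]
  -- Truncating at `l ≤ j` loses nothing, since `l ≤ n l`.
  let z : ℕ → E := fun j => ∑ l ∈ Finset.range (j + 1), if n l ≤ j then y l (j - n l) else 0
  -- This is block `l` after `n k` shifts, for `l > k` only: earlier blocks have been shifted out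
  -- and block `k` cancels with `y k`.
  let t : ℕ → ℕ → ℕ → E := fun k l j =>
    if k < l ∧ n l - n k ≤ j then y l (j - (n l - n k)) else 0
  have hzt : ∀ k j, z (j + n k) - y k j = ∑ l ∈ Finset.range (j + n k + 1), t k l j := by
    intro k j
    have hterm : ∀ l ∈ Finset.range (j + n k + 1),
        (if n l ≤ j + n k then y l (j + n k - n l) else 0) =
          t k l j + if l = k then y k j else 0 := by
      intro l _
      simp only [t]
      rcases lt_trichotomy l k with h | rfl | h
      · have := hlt l k h
        rw [if_pos (by omega), hD l _ (by omega), if_neg (by omega), if_neg h.ne, add_zero]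
      · rw [if_pos (by omega), if_neg (by omega), if_pos rfl, zero_add, Nat.add_sub_cancel]
      · have := hmono h
        rw [if_neg h.ne', add_zero]
        by_cases hj : n l ≤ j + n k
        · rw [if_pos hj, if_pos ⟨h, by omega⟩]
          congr 1
          omega
        · rw [if_neg hj, if_neg (by omega)]
    have hk : k ∈ Finset.range (j + n k + 1) := by
      have := hmono.le_apply (x := k)
      exact Finset.mem_range.2 (by omega)
    simp only [z]
    rw [Finset.sum_congr rfl hterm, Finset.sum_add_distrib, Finset.sum_ite_eq', if_pos hk,
      add_sub_cancel_right]
  have hblock : ∀ k l, ∑' j, ‖t k l j‖ₑ * ENNReal.ofReal (c j) ≤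
      ENNReal.ofReal ((1 / 2 : ℝ) ^ k * (1 / 2 : ℝ) ^ l) := by
    intro k l
    by_cases hkl : k < l
    · have hsupp : ∀ j ∉ Finset.Ico (n l - n k) (n l - n k + D l),
          ‖t k l j‖ₑ * ENNReal.ofReal (c j) = 0 := by
        intro j hj
        rw [Finset.mem_Ico] at hj
        have : t k l j = 0 := by
          simp only [t]
          split_ifs with h
          · exact hD _ _ (by omega)
          · rfl
        rw [this, enorm_zero, zero_mul]
      rw [tsum_eq_sum hsupp, Finset.sum_Ico_eq_sum_range, Nat.add_sub_cancel_left]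
      calc ∑ i ∈ Finset.range (D l), ‖t k l (n l - n k + i)‖ₑ *
              ENNReal.ofReal (c (n l - n k + i))
          ≤ ∑ i ∈ Finset.range (D l), ENNReal.ofReal (‖y l i‖ * ε l) := by
            refine Finset.sum_le_sum fun i hi => ?_
            have : t k l (n l - n k + i) = y l i := by
              simp only [t]
              rw [if_pos ⟨hkl, by omega⟩, Nat.add_sub_cancel_left]
            rw [this, ENNReal.ofReal_mul (norm_nonneg _), ofReal_norm]
            gcongr
            exact (hsmall k l i hkl (Finset.mem_range.1 hi)).le
        _ = ENNReal.ofReal (M l * ε l) := by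
            rw [← ENNReal.ofReal_sum_of_nonneg fun i _ => mul_nonneg (norm_nonneg _) (hε l).le,
              ← Finset.sum_mul]
        _ ≤ ENNReal.ofReal ((1 / 2 : ℝ) ^ k * (1 / 2 : ℝ) ^ l) := by
            refine ENNReal.ofReal_le_ofReal ?_
            have h1 : M l * ε l ≤ (1 / 2 : ℝ) ^ l * (1 / 2 : ℝ) ^ l := by
              simp only [ε]
              rw [mul_div_assoc', div_le_iff₀ (by linarith [hM l]), mul_comm]
              gcongr
              linarith
            refine h1.trans ?_
            gcongr ?_ * _
            exact pow_le_pow_of_le_one (by norm_num) (by norm_num) hkl.le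
    · have : ∀ j, t k l j = 0 := fun j => if_neg fun h => hkl h.1
      simp [this]
  refine ⟨n, z, hn0, fun k => ?_⟩
  refine summable_and_tsum_le_of_ofReal (fun j => mul_nonneg (norm_nonneg _) (hc j))
    (by positivity) ?_
  calc ∑' j, ENNReal.ofReal (‖z (j + n k) - y k j‖ * c j)
      ≤ ∑' j, ∑' l, ‖t k l j‖ₑ * ENNReal.ofReal (c j) := by
        refine ENNReal.tsum_le_tsum fun j => ?_
        rw [ENNReal.ofReal_mul (norm_nonneg _), ofReal_norm, ENNReal.tsum_mul_right, hzt]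
        gcongr
        exact (enorm_sum_le _ _).trans (ENNReal.sum_le_tsum _)
    _ = ∑' l, ∑' j, ‖t k l j‖ₑ * ENNReal.ofReal (c j) := ENNReal.tsum_comm
    _ ≤ ∑' l, ENNReal.ofReal ((1 / 2 : ℝ) ^ k * (1 / 2 : ℝ) ^ l) :=
        ENNReal.tsum_le_tsum (hblock k)
    _ = ENNReal.ofReal (2 * (1 / 2 : ℝ) ^ k) := by
        rw [← ENNReal.ofReal_tsum_of_nonneg (fun l => by positivity)
          (summable_geometric_two.mul_left _), tsum_mul_left, tsum_geometric_two, mul_comm]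

/-- There is a sequence that starts at `0` and attains each of countably many values infinitely
often. -/
theorem exists_seq_frequently {α : Type*} [Countable α] (o : α) :
    ∃ f : ℕ → α, f 0 = o ∧ ∀ a N, ∃ k, N ≤ k ∧ f k = a := by
  have : Nonempty α := ⟨o⟩
  obtain ⟨r, hr⟩ := exists_surjective_nat α
  refine ⟨fun k => Nat.casesOn k o fun k => r (Nat.unpair k).1, rfl, fun a N => ?_⟩
  obtain ⟨i, rfl⟩ := hr a
  exact ⟨Nat.pair i N + 1, (Nat.right_le_pair i N).trans (Nat.le_succ _), by simp⟩

theorem isSeqHypercyclic_of_thick (hw : ∀ j, w j ≠ 0) (hψ : IsSymbol ψ)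
    (hB : ∀ x ∈ coechelon 𝕜 p V, backwardShift w ψ x ∈ coechelon 𝕜 p V) {m : ℕ} {I : Set ℕ}
    (hI : LinDyn.IsThick I) (hlim : Tendsto (quot V w ψ m) (atTop ⊓ 𝓟 I) (𝓝 0)) :
    LinDyn.IsSeqHypercyclic (shiftOn p V w ψ hB) := by
  have hwin : ∀ ε : ℝ, 0 < ε → ∀ N L : ℕ, ∃ s, N ≤ s ∧ ∀ i ≤ L, quot V w ψ m (s + i) < ε := by
    intro ε hε N L
    have h := hlim.eventually (gt_mem_nhds hε)
    rw [eventually_inf_principal] at h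
    obtain ⟨J, hJ⟩ := eventually_atTop.1 h
    obtain ⟨j, -, hj⟩ := hI (J + N + L)
    -- Skipping the first `J + N` entries of the run in `I` puts the window beyond both `J` and `N`,
    -- with `L + 1` entries left.
    refine ⟨j + (J + N), by omega, fun i hi => hJ _ (by omega) ?_⟩
    rw [add_assoc]
    exact hj _ (by omega)
  obtain ⟨s, hs0, hs⟩ := exists_dense_seq_zero 𝕜
  obtain ⟨f, hf0, hf⟩ := exists_seq_frequently (0 : ℕ →₀ ℕ)
  have hD : ∀ l j, (f l).support.sup id + 1 ≤ j → s (f l j) = 0 := by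
    intro l j hj
    rw [Finsupp.notMem_support_iff.1, hs0]
    intro h
    have : j ≤ (f l).support.sup id := Finset.le_sup (f := id) h
    omega
  obtain ⟨n, z, hn0, hz⟩ := exists_block_sequence (fun j => (quot_pos hw m j).le) hwin
    (y := fun l j => s (f l j)) hD
  obtain ⟨x, hx⟩ : ∃ x : Coechelon 𝕜 p V, ∀ j, coord p V w ψ j x = z j := by
    refine exists_coord_eq hw hψ (m := m) (MemSeq.of_summable_norm ?_)
    -- Since `n 0 = 0` and block `0` vanishes, the estimate for `k = 0` is the summability of `z`
    -- itself.
    have := (hz 0).1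
    simp only [hn0, hf0, Finsupp.coe_zero, Pi.zero_apply, hs0, sub_zero, add_zero] at this
    exact this.norm
  choose g hg using fun k =>
    exists_coord_eq_of_finite (p := p) (V := V) hw hψ (z := fun j => s (f k j)) (hD k)
  let T := shiftOn p V w ψ hB
  have hcoord : ∀ k j, coord p V w ψ j (T^[n k] x - g k) = z (j + n k) - s (f k j) := by
    intro k j
    rw [map_sub, coord_iterate_shiftOn, hx, hg]
  have hdiff : Tendsto (fun k => T^[n k] x - g k) atTop (𝓝 0) := by
    refine tendsto_def.2 fun O hO => ?_
    obtain ⟨δ, hδ, hball⟩ := exists_ball_subset hw hψ hO m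
    have h1 : Tendsto (fun k : ℕ => 2 * (1 / 2 : ℝ) ^ k) atTop (𝓝 0) := by
      simpa using (tendsto_pow_atTop_nhds_zero_of_lt_one (r := (1 / 2 : ℝ)) (by norm_num)
        (by norm_num)).const_mul 2
    filter_upwards [h1.eventually (gt_mem_nhds hδ)] with k hk
    refine hball _ ?_ ?_
    · simp only [hcoord]
      exact (hz k).1
    · simp only [hcoord]
      exact (hz k).2.trans_lt hk
  refine ⟨x, eq_univ_of_forall fun y => ?_⟩
  obtain ⟨b, g', hg', hlim'⟩ := exists_seq_tendsto hw hψ hs0 hs y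
  -- Every finite vector recurs as a block infinitely often, so the approximants of `y` occur at
  -- times tending to infinity, where the error `T^[n k] x - g k` vanishes in the limit.
  choose k hk hkb using fun a => hf (b a) a
  refine ⟨fun a => T^[n (k a)] x, fun a => ⟨n (k a), rfl⟩, ?_⟩
  have h1 := (hdiff.comp (tendsto_atTop_mono hk tendsto_id)).add hlim'
  rw [zero_add] at h1
  refine h1.congr fun a => ?_
  have : g' a = g (k a) := ext_coord hw hψ fun j => by rw [hg', hg, hkb]
  rw [Function.comp_apply, this, sub_add_cancel]

theorem exists_thick_of_isHypercyclic (hw : ∀ j, w j ≠ 0) (hψ : IsSymbol ψ)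
    (hB : ∀ x ∈ coechelon 𝕜 p V, backwardShift w ψ x ∈ coechelon 𝕜 p V)
    (h : LinDyn.IsHypercyclic (shiftOn p V w ψ hB)) :
    ∃ (m : ℕ) (I : Set ℕ), LinDyn.IsThick I ∧
      Tendsto (quot V w ψ m) (atTop ⊓ 𝓟 I) (𝓝 0) := by
  obtain ⟨x, hx⟩ := h
  obtain ⟨m, hm⟩ := exists_memSeq_coord hw hψ x
  refine ⟨m, {j | 1 ≤ ‖coord p V w ψ j x‖}, fun q => ?_, ?_⟩
  · let O : Set (Coechelon 𝕜 p V) := ⋂ i ∈ Finset.range (q + 2), {y | 1 < ‖coord p V w ψ i y‖}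
    have hO : IsOpen O := isOpen_biInter_finset fun i _ =>
      isOpen_lt continuous_const (continuous_coord hw i).norm
    obtain ⟨y, hy⟩ := exists_coord_eq_of_finite (p := p) (V := V) hw hψ (D := q + 2)
      (z := fun j => if j < q + 2 then 2 else 0) fun j hj => if_neg (by omega)
    have hyO : y ∈ O := mem_iInter₂.2 fun i hi => by
      rw [mem_ofPred_eq, hy, if_pos (Finset.mem_range.1 hi)]
      simp
    obtain ⟨_, hO', n, rfl⟩ := hx.inter_open_nonempty O hO ⟨y, hyO⟩
    refine ⟨n + 1, by omega, fun i hi => ?_⟩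
    have := mem_iInter₂.1 hO' (i + 1) (Finset.mem_range.2 (by omega))
    rw [mem_ofPred_eq, coord_iterate_shiftOn] at this
    rw [mem_ofPred_eq, show n + 1 + i = i + 1 + n by omega]
    exact this.le
  · have h0 := hm.tendsto_zero
    rw [Nat.cofinite_eq_atTop] at h0
    refine squeeze_zero' (Eventually.of_forall fun j => (quot_pos hw m j).le) ?_
      (h0.mono_left inf_le_left)
    rw [eventually_inf_principal]
    refine Eventually.of_forall fun j hj => ?_
    exact le_mul_of_one_le_left (quot_pos hw m j).le hj

/-! ### Periodic points -/

theorem exists_memSeq_quot_of_periodic (hw : ∀ j, w j ≠ 0) (hψ : IsSymbol ψ)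
    (hB : ∀ x ∈ coechelon 𝕜 p V, backwardShift w ψ x ∈ coechelon 𝕜 p V)
    {x : Coechelon 𝕜 p V} (hx0 : x ≠ 0) (hx : x ∈ Function.periodicPts (shiftOn p V w ψ hB)) :
    ∃ m, MemSeq p (quot V w ψ m) := by
  obtain ⟨q, hq, hqx⟩ := hx
  have hper : ∀ k j, coord p V w ψ (j + q * k) x = coord p V w ψ j x := by
    intro k
    induction k with
    | zero => intro j; rfl
    | succ k ih =>
      intro j
      rw [mul_add, mul_one, ← add_assoc, ← coord_iterate_shiftOn hB, hqx.eq, ih]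
  obtain ⟨i, hi⟩ : ∃ i, coord p V w ψ i x ≠ 0 := by
    by_contra! h
    exact hx0 (ext_coord hw hψ fun j => by rw [h, map_zero])
  -- Each iterate of `x` may lie in a different step; finitely many of them share one, by taking the
  -- maximum.
  have hsum : ∀ n, ∃ m, MemSeq p fun j =>
      (∑ r ∈ Finset.range n, ‖coord p V w ψ (j + r) x‖) * quot V w ψ m j := by
    intro n
    induction n with
    | zero => exact ⟨0, by simpa [Pi.zero_def] using (MemSeq.zero : MemSeq p (0 : ℕ → ℝ))⟩
    | succ n ih =>
      obtain ⟨m, hm⟩ := ih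
      obtain ⟨m', hm'⟩ := exists_memSeq_coord hw hψ ((shiftOn p V w ψ hB)^[n] x)
      refine ⟨max m m', (hm.add hm').of_norm_le fun j => ?_⟩
      have h1 := quot_anti (V := V) w ψ (le_max_left m m') j
      have h2 := quot_anti (V := V) w ψ (le_max_right m m') j
      have h3 := quot_pos (V := V) (ψ := ψ) hw (max m m') j
      rw [Finset.sum_range_succ, Pi.add_apply, coord_iterate_shiftOn,
        Real.norm_of_nonneg (by positivity)]
      refine le_trans ?_ (le_abs_self _)
      rw [add_mul]
      gcongr
  obtain ⟨m, hm⟩ := hsum q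
  refine ⟨m, (hm.const_smul ‖coord p V w ψ i x‖⁻¹).of_norm_le fun j => ?_⟩
  have hj := quot_pos (V := V) (ψ := ψ) hw m j
  have hi' := norm_pos_iff.2 hi
  rw [Pi.smul_apply, smul_eq_mul, Real.norm_of_nonneg hj.le]
  refine le_trans ?_ (le_abs_self _)
  rw [← div_eq_inv_mul, le_div_iff₀ hi', mul_comm]
  gcongr
  -- Adding `q * j` makes the subtraction genuine. The remainder modulo `q` then locates an index
  -- congruent to `i` among `j, …, j + q - 1`.
  have hle : j ≤ i + q * j := (Nat.le_mul_of_pos_left j hq).trans (Nat.le_add_left _ _)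
  have hr : coord p V w ψ (j + (i + q * j - j) % q) x = coord p V w ψ i x := by
    rw [← hper ((i + q * j - j) / q), add_assoc, Nat.mod_add_div, Nat.add_sub_cancel' hle, hper]
  rw [← hr]
  exact Finset.single_le_sum (f := fun r => ‖coord p V w ψ (j + r) x‖)
    (fun _ _ => norm_nonneg _) (Finset.mem_range.2 (Nat.mod_lt _ hq))

/-- Membership of the quotients makes every bounded coordinate sequence an element of the space.
Periodizations of a finite vector, with growing periods, are dominated by a constant sequence and
converge to that vector. -/
theorem dense_periodicPts (hw : ∀ j, w j ≠ 0) (hψ : IsSymbol ψ)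
    (hB : ∀ x ∈ coechelon 𝕜 p V, backwardShift w ψ x ∈ coechelon 𝕜 p V) {m : ℕ}
    (hm : MemSeq p (quot V w ψ m)) : Dense (Function.periodicPts (shiftOn p V w ψ hB)) := by
  refine dense_iff_inter_open.2 fun U hU hne => ?_
  obtain ⟨u, hu, D, hD⟩ := exists_finite_mem_of_isOpen hw hψ hU hne
  let C : ℝ := ∑ i ∈ Finset.range D, ‖coord p V w ψ i u‖
  have hC0 : 0 ≤ C := Finset.sum_nonneg fun _ _ => norm_nonneg _
  have hC : ∀ i, ‖coord p V w ψ i u‖ ≤ C := fun i => by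
    by_cases hi : i < D
    · exact Finset.single_le_sum (f := fun i => ‖coord p V w ψ i u‖)
        (fun _ _ => norm_nonneg _) (Finset.mem_range.2 hi)
    · rw [hD i (by omega), norm_zero]
      exact hC0
  have hbdd : ∀ z : ℕ → 𝕜, (∀ j, ‖z j‖ ≤ C) →
      ∃ x : Coechelon 𝕜 p V, ∀ j, coord p V w ψ j x = z j := fun z hz => by
    refine exists_coord_eq hw hψ (m := m) ((hm.const_smul C).of_norm_le fun j => ?_)
    rw [Pi.smul_apply, norm_smul, norm_mul, norm_norm, Real.norm_of_nonneg hC0]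
    gcongr
    exact hz j
  choose x hx using fun a : ℕ => hbdd (fun j => coord p V w ψ (j % (a + D + 1)) u) fun j => hC _
  obtain ⟨f, hf⟩ := hbdd (fun _ => (C : 𝕜)) fun j => by
    rw [RCLike.norm_ofReal, abs_of_nonneg hC0]
  have hlim : Tendsto x atTop (𝓝 u) := by
    refine tendsto_of_dominated hw hψ (f := f) (fun a j => ?_) fun j => ?_
    · rw [hf, hx, RCLike.norm_ofReal, abs_of_nonneg hC0]
      -- Within the first period the periodization agrees with `u`; beyond it `u` vanishes.
      by_cases hj : j < a + D + 1
      · rwa [Nat.mod_eq_of_lt hj, sub_self, norm_zero]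
      · rw [hD j (by omega), sub_zero]
        exact hC _
    · refine tendsto_const_nhds.congr' ?_
      filter_upwards [eventually_gt_atTop j] with a ha
      rw [hx, Nat.mod_eq_of_lt (by omega)]
  obtain ⟨a, ha⟩ := (hlim.eventually (hU.mem_nhds hu)).exists
  refine ⟨x a, ha, a + D + 1, by omega, ext_coord hw hψ fun j => ?_⟩
  rw [coord_iterate_shiftOn, hx, hx, Nat.add_mod_right]

/-! ### The dynamical characterizations -/

theorem isTransitive_iff (hw : ∀ j, w j ≠ 0) (hψ : IsSymbol ψ)
    {hB : ∀ x ∈ coechelon 𝕜 p V, backwardShift w ψ x ∈ coechelon 𝕜 p V}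
    (hcont : Continuous (shiftOn p V w ψ hB)) :
    LinDyn.IsTransitive (shiftOn p V w ψ hB) ↔
      ∃ m : ℕ, liminf (fun j : ℕ => (quot V w ψ m j : EReal)) atTop = 0 := by
  constructor
  · intro hT
    by_contra! h
    obtain ⟨U, W, hU, hUne, hW, hWne, hdisj⟩ := exists_returnSet_disjoint hw hψ hB (I := univ)
      fun m => exists_forall_le_of_liminf_ne_zero (quot_pos hw m) (by simpa using h m)
    obtain ⟨n, hn⟩ := hT U W hU hUne hW hWne
    exact hdisj n (mem_univ n) hn
  · rintro ⟨m, hm⟩ U W hU hUne hW hWne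
    rw [liminf_eq_zero_iff fun j => (quot_pos hw m j).le] at hm
    obtain ⟨d, N, h⟩ := exists_sub_mem_returnSet hw hψ hcont hU hUne hW hWne
    obtain ⟨δ, hδ, h⟩ := h m
    obtain ⟨j, hj, hjδ⟩ := frequently_atTop.1 (hm δ hδ) N
    exact ⟨j - d, h j hj hjδ⟩

theorem isMixing_iff (hw : ∀ j, w j ≠ 0) (hψ : IsSymbol ψ)
    {hB : ∀ x ∈ coechelon 𝕜 p V, backwardShift w ψ x ∈ coechelon 𝕜 p V}
    (hcont : Continuous (shiftOn p V w ψ hB)) :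
    LinDyn.IsMixing (shiftOn p V w ψ hB) ↔
      ∀ I : Set ℕ, I.Infinite →
        ∃ m : ℕ, liminf (fun j : ℕ => (quot V w ψ m j : EReal)) (atTop ⊓ 𝓟 I) = 0 := by
  constructor
  · intro hT I hI
    by_contra! h
    obtain ⟨U, W, hU, hUne, hW, hWne, hdisj⟩ := exists_returnSet_disjoint hw hψ hB
      fun m => exists_forall_le_of_liminf_ne_zero (quot_pos hw m) (h m)
    exact hI ((hT U W hU hUne hW hWne).subset hdisj)
  · intro h U W hU hUne hW hWne
    obtain ⟨d, N, hret⟩ := exists_sub_mem_returnSet hw hψ hcont hU hUne hW hWne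
    by_contra hinf
    -- If infinitely many times are missed, their translate by `d` contains some large `n + d` with
    -- small quotient, which makes `n` a return time after all.
    obtain ⟨m, hm⟩ := h ((· + d) '' (LinDyn.returnSet (shiftOn p V w ψ hB) U W)ᶜ)
      (Set.Infinite.image (add_left_injective d).injOn hinf)
    rw [liminf_eq_zero_iff fun j => (quot_pos hw m j).le] at hm
    obtain ⟨δ, hδ, hret⟩ := hret m
    have hfreq := frequently_inf_principal.1 (hm δ hδ)
    obtain ⟨_, hj, ⟨n, hn, rfl⟩, hjδ⟩ := frequently_atTop.1 hfreq N
    refine hn ?_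
    simpa using hret (n + d) hj hjδ

theorem isTopErgodic_of_syndetic (hw : ∀ j, w j ≠ 0) (hψ : IsSymbol ψ)
    {hB : ∀ x ∈ coechelon 𝕜 p V, backwardShift w ψ x ∈ coechelon 𝕜 p V}
    (hcont : Continuous (shiftOn p V w ψ hB)) {m : ℕ}
    (h : ∀ ε : ℝ, 0 < ε → LinDyn.IsSyndetic {j : ℕ | quot V w ψ m j < ε}) :
    LinDyn.IsTopErgodic (shiftOn p V w ψ hB) := by
  intro U W hU hUne hW hWne
  obtain ⟨d, N, hret⟩ := exists_sub_mem_returnSet hw hψ hcont hU hUne hW hWne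
  obtain ⟨δ, hδ, hret⟩ := hret m
  obtain ⟨q, hq⟩ := h δ hδ
  -- Starting the search at `n + N + d` pays for the threshold `N` and the translation by `d`; this
  -- enlarges the gap from `q` to `N + q`.
  refine ⟨N + q, fun n hn => ?_⟩
  obtain ⟨i, hi, hiδ⟩ := hq (n + (N + d)) (by omega)
  refine ⟨N + i, by omega, ?_⟩
  have := hret (n + (N + d) + i) (by omega) hiδ
  rwa [show n + (N + d) + i - d = n + (N + i) by omega] at this

theorem isTransitive_of_memSeq (hw : ∀ j, w j ≠ 0) (hψ : IsSymbol ψ)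
    {hB : ∀ x ∈ coechelon 𝕜 p V, backwardShift w ψ x ∈ coechelon 𝕜 p V}
    (hcont : Continuous (shiftOn p V w ψ hB)) {m : ℕ} (hm : MemSeq p (quot V w ψ m)) :
    LinDyn.IsTransitive (shiftOn p V w ψ hB) := by
  refine (isTransitive_iff hw hψ hcont).2 ⟨m, ?_⟩
  rw [liminf_eq_zero_iff fun j => (quot_pos hw m j).le]
  have h0 := hm.tendsto_zero
  rw [Nat.cofinite_eq_atTop] at h0
  exact fun ε hε => (h0.eventually (gt_mem_nhds hε)).frequently

theorem exists_periodic_of_dense (hw : ∀ j, w j ≠ 0) (hψ : IsSymbol ψ)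
    {hB : ∀ x ∈ coechelon 𝕜 p V, backwardShift w ψ x ∈ coechelon 𝕜 p V}
    (h : Dense (Function.periodicPts (shiftOn p V w ψ hB))) :
    ∃ x : Coechelon 𝕜 p V, x ≠ 0 ∧ x ∈ Function.periodicPts (shiftOn p V w ψ hB) := by
  obtain ⟨e, he⟩ := exists_unit (p := p) (V := V) hw hψ 0
  obtain ⟨x, hx0, hx⟩ := h.inter_open_nonempty {x | 0 < ‖coord p V w ψ 0 x‖}
    (isOpen_lt continuous_const (continuous_coord hw 0).norm) ⟨e, by simp [he]⟩
  refine ⟨x, ?_, hx⟩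
  rintro rfl
  simp at hx0

end Kothe

theorem mainTheorem6 {𝕜 : Type*} [RCLike 𝕜] (p : Kothe.Exponent) (V : Kothe.WeightSeq)
    (w : ℕ+ → 𝕜) (hw : ∀ j, w j ≠ 0) (ψ : ℕ+ → ℕ+) (hψ : Kothe.IsSymbol ψ)
    (hB : ∀ x ∈ Kothe.coechelon 𝕜 p V,
      Kothe.backwardShift w ψ x ∈ Kothe.coechelon 𝕜 p V)
    (hcont : Continuous (Kothe.shiftOn p V w ψ hB)) :
    -- a) transitivity
    (LinDyn.IsTransitive (Kothe.shiftOn p V w ψ hB) ↔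
      ∃ m : ℕ, liminf (fun j : ℕ => (Kothe.quot V w ψ m j : EReal)) atTop = 0) ∧
    -- b) hypercyclicity and sequential hypercyclicity
    List.TFAE [
      LinDyn.IsSeqHypercyclic (Kothe.shiftOn p V w ψ hB),
      LinDyn.IsHypercyclic (Kothe.shiftOn p V w ψ hB),
      ∃ (m : ℕ) (I : Set ℕ), LinDyn.IsThick I ∧
        Tendsto (Kothe.quot V w ψ m) (atTop ⊓ 𝓟 I) (𝓝 0)] ∧
    -- c) mixing
    (LinDyn.IsMixing (Kothe.shiftOn p V w ψ hB) ↔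
      ∀ I : Set ℕ, I.Infinite →
        ∃ m : ℕ, liminf (fun j : ℕ => (Kothe.quot V w ψ m j : EReal)) (atTop ⊓ 𝓟 I) = 0) ∧
    -- d) a sufficient condition for topological ergodicity
    ((∃ m : ℕ, ∀ ε : ℝ, 0 < ε → LinDyn.IsSyndetic {j : ℕ | Kothe.quot V w ψ m j < ε}) →
      LinDyn.IsTopErgodic (Kothe.shiftOn p V w ψ hB)) ∧
    -- e) periodic points and chaos
    List.TFAE [
      ∃ x : Kothe.Coechelon 𝕜 p V, x ≠ 0 ∧
        x ∈ Function.periodicPts (Kothe.shiftOn p V w ψ hB),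
      ∃ m : ℕ, Kothe.MemSeq p (Kothe.quot V w ψ m),
      LinDyn.IsChaotic (Kothe.shiftOn p V w ψ hB)] := by
  refine ⟨Kothe.isTransitive_iff hw hψ hcont, ?_, Kothe.isMixing_iff hw hψ hcont, ?_, ?_⟩
  · tfae_have 1 → 2 := fun ⟨x, hx⟩ =>
      ⟨x, fun y => seqClosure_subset_closure (hx.symm ▸ mem_univ y)⟩
    tfae_have 2 → 3 := Kothe.exists_thick_of_isHypercyclic hw hψ hB
    tfae_have 3 → 1 := fun ⟨_, _, hI, hlim⟩ => Kothe.isSeqHypercyclic_of_thick hw hψ hB hI hlim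
    tfae_finish
  · rintro ⟨m, hm⟩
    exact Kothe.isTopErgodic_of_syndetic hw hψ hcont hm
  · tfae_have 1 → 2 := fun ⟨_, hx0, hx⟩ => Kothe.exists_memSeq_quot_of_periodic hw hψ hB hx0 hx
    tfae_have 2 → 3 := fun ⟨_, hm⟩ =>
      ⟨Kothe.isTransitive_of_memSeq hw hψ hcont hm, Kothe.dense_periodicPts hw hψ hB hm⟩
    tfae_have 3 → 1 := fun h => Kothe.exists_periodic_of_dense hw hψ h.2
    tfae_finish
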